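/- A sequence of prefix-rotations $\sigma_{r_1},\sigma_{r_2},\dots$ is written $r_1,r_2,\dots$. For a sequence $S=r_1,r_2,\dots$ define - $\mathrm{reuse}_n(S)$: replace every symbol $r$ of $S$ by $n,\dots,n,\;n+1-r$, with $n-1$ copies of $n$; - $\mathrm{recycle}_n(S)$: replace every symbol $r$ of $S$ by $n,n,\;n-1,\dots,n-1,\;n,\dots,n$, with $r-1$ copies of $n-1$ followed by $n-r-1$ copies of $n$; - $\mathrm{shift}^2(r_1,\dots,r_k)=r_3,\dots,r_k,r_1,r_2$; - for $S=T,n-1,n-1$ and $m\ge 2$, $\mathrm{rewind}_{n,m}(S)$: the sequence $T,n-1,n$, followed by $m-2$ copies of $T,n$, followed by $T,n-1,n$, followed by $m-2$ copies of $n$. Let $C_1=1$ and $C_k=\mathrm{recycle}_k(C_{k-1})$ for $k\ge 2$. Then each of the following three families of sequences can be generated by a loopless algorithm: 1. $\mathrm{reuse}_n(C_{n-1})$, for $n\ge 2$ (input $n$); 2. $\mathrm{rewind}_{n,m}(\mathrm{shift}^2(C_{n-1}))$, for $n\ge 3$ and $m\in\{2,\dots,n\}$ (input $n,m$); 3. $\mathrm{rewind}_{n,m}(\mathrm{shift}^2(\mathrm{reuse}_{n-1}(C_{n-2})))$,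 for $n\ge 3$ and $m\in\{2,\dots,n\}$ (input $n,m$). That is, for each family there are one program for a unit-cost word RAM and one constant $c$, both independent of $n$ and $m$, such that on every admissible input the program terminates and visits (outputs) exactly the symbols of the sequence in order. All numbers it stores, all array indices it writes to and all symbols it visits are at most $cn$; the first symbol is visited within time $cn$ (initialization); after that the time between two successive visits, and between the last visit and termination, is at most $c$ in the worst case. -/

import Mathlib

namespace Rotator

/-! ### The sequences

A sequence of rotations `σ_{r₁}, σ_{r₂}, …` is represented by the list `[r₁, r₂, …]`. -/

/-- Reusing: every `r` is replaced by `n, …, n, n+1-r`, with `n - 1` copies of `n`. -/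
def reuse (n : ℕ) (S : List ℕ) : List ℕ :=
  S.flatMap fun r => List.replicate (n - 1) n ++ [n + 1 - r]

/-- Recycling: every `r` is replaced by `n, n, n-1, …, n-1, n, …, n`, with `r - 1` copies
of `n - 1` and then `n - r - 1` copies of `n`. -/
def recycle (n : ℕ) (S : List ℕ) : List ℕ :=
  S.flatMap fun r => [n, n] ++ List.replicate (r - 1) (n - 1) ++ List.replicate (n - r - 1) n

/-- The canonical recycle sequences: the first is `1`, and the `k`-th is obtained by recycling
the `(k-1)`-st, whose largest symbol is `k - 1`. (The value at `0` is never used.) -/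
def recycleSeq : ℕ → List ℕ
  | 0 => []
  | 1 => [1]
  | k + 2 => recycle (k + 2) (recycleSeq (k + 1))

/-- Rewinding, for `S = T, n-1, n-1` and `m ≥ 2`: the sequence
`T, n-1, n`, then `m - 2` copies of `T, n`, then `T, n-1, n`, then `m - 2` copies of `n`. -/
def rewind (n m : ℕ) (S : List ℕ) : List ℕ :=
  let T := S.dropLast.dropLast
  T ++ [n - 1, n] ++ (List.replicate (m - 2) (T ++ [n])).flatten ++ T ++ [n - 1, n] ++
    List.replicate (m - 2) n

/-- `r₁, …, r_k` shifted twice: `r₃, …, r_k, r₁, r₂`. -/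
def shiftTwo (S : List ℕ) : List ℕ := S.rotate 2

/-! ### The machine model

A word RAM with structured control. A program handles finitely many scalar variables and
finitely many arrays (those named in its text), all holding natural numbers. An elementary
operation (constant, variable access, array access, addition, truncated subtraction,
remainder, comparison, assignment, call of the output routine) takes one unit of time. -/

/-- Expressions. -/
inductive Expr where
  | const (c : ℕ)
  | var (x : ℕ)
  | get (a : ℕ) (i : Expr)
  | add (e₁ e₂ : Expr)
  | sub (e₁ e₂ : Expr)
  | mod (e₁ e₂ : Expr)

/-- Commands. The guards of `ite` and `loop` are comparisons `e₁ ≤ e₂`. -/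
inductive Cmd where
  | skip
  | assign (x : ℕ) (e : Expr)
  | put (a : ℕ) (i e : Expr)
  | visit (e : Expr)
  | seq (p q : Cmd)
  | ite (e₁ e₂ : Expr) (p q : Cmd)
  | loop (e₁ e₂ : Expr) (p : Cmd)

/-- A memory state: the values of the scalar variables and the contents of the arrays. -/
structure Store where
  var : ℕ → ℕ
  arr : ℕ → ℕ → ℕ

/-- The initial state: the inputs are in the first variables, everything else is `0`. -/
def Store.input (args : List ℕ) : Store where
  var x := args.getD x 0
  arr _ _ := 0

/-- The state after the assignment of `v` to the variable `x`. -/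
def Store.setVar (s : Store) (x v : ℕ) : Store :=
  { s with var := Function.update s.var x v }

/-- The state after the assignment of `v` to the `i`-th cell of the array `a`. -/
def Store.setArr (s : Store) (a i v : ℕ) : Store :=
  { s with arr := Function.update s.arr a (Function.update (s.arr a) i v) }

/-- The value of an expression. -/
def Expr.eval (s : Store) : Expr → ℕ
  | .const c => c
  | .var x => s.var x
  | .get a i => s.arr a (i.eval s)
  | .add e₁ e₂ => e₁.eval s + e₂.eval s
  | .sub e₁ e₂ => e₁.eval s - e₂.eval s
  | .mod e₁ e₂ => e₁.eval s % e₂.eval s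

/-- The time needed to evaluate an expression: the number of its operations. -/
def Expr.cost : Expr → ℕ
  | .const _ => 1
  | .var _ => 1
  | .get _ i => i.cost + 1
  | .add e₁ e₂ => e₁.cost + e₂.cost + 1
  | .sub e₁ e₂ => e₁.cost + e₂.cost + 1
  | .mod e₁ e₂ => e₁.cost + e₂.cost + 1

/-- What an observer sees of a run: units of time that pass, and visited symbols. -/
inductive Event where
  | tick
  | visit (r : ℕ)

/-- `k` units of time. -/
def ticks (k : ℕ) : List Event := List.replicate k Event.tick

/-- `Exec W p s tr s'`: the program `p`, started in the state `s`, terminates in the state `s'`,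
and `tr` is the list of events of the run in chronological order. A machine word holds the
numbers `0, …, W`: a run that would store or visit a number above `W`, or write to an array
cell with an index above `W`, gets stuck. -/
inductive Exec (W : ℕ) : Cmd → Store → List Event → Store → Prop
  | skip (s : Store) : Exec W .skip s (ticks 1) s
  | assign (s : Store) (x : ℕ) (e : Expr) (he : e.eval s ≤ W) :
      Exec W (.assign x e) s (ticks (e.cost + 1)) (s.setVar x (e.eval s))
  | put (s : Store) (a : ℕ) (i e : Expr) (hi : i.eval s ≤ W) (he : e.eval s ≤ W) :
      Exec W (.put a i e) s (ticks (i.cost + e.cost + 1)) (s.setArr a (i.eval s) (e.eval s))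
  | visit (s : Store) (e : Expr) (he : e.eval s ≤ W) :
      Exec W (.visit e) s (ticks (e.cost + 1) ++ [Event.visit (e.eval s)]) s
  | seq (p q : Cmd) (s s' s'' : Store) (tr tr' : List Event)
      (hp : Exec W p s tr s') (hq : Exec W q s' tr' s'') :
      Exec W (.seq p q) s (tr ++ tr') s''
  | ite_true (e₁ e₂ : Expr) (p q : Cmd) (s s' : Store) (tr : List Event)
      (h : e₁.eval s ≤ e₂.eval s) (hp : Exec W p s tr s') :
      Exec W (.ite e₁ e₂ p q) s (ticks (e₁.cost + e₂.cost + 1) ++ tr) s'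
  | ite_false (e₁ e₂ : Expr) (p q : Cmd) (s s' : Store) (tr : List Event)
      (h : ¬ e₁.eval s ≤ e₂.eval s) (hq : Exec W q s tr s') :
      Exec W (.ite e₁ e₂ p q) s (ticks (e₁.cost + e₂.cost + 1) ++ tr) s'
  | loop_true (e₁ e₂ : Expr) (p : Cmd) (s s' s'' : Store) (tr tr' : List Event)
      (h : e₁.eval s ≤ e₂.eval s) (hp : Exec W p s tr s')
      (hl : Exec W (.loop e₁ e₂ p) s' tr' s'') :
      Exec W (.loop e₁ e₂ p) s (ticks (e₁.cost + e₂.cost + 1) ++ (tr ++ tr')) s''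
  | loop_false (e₁ e₂ : Expr) (p : Cmd) (s : Store)
      (h : ¬ e₁.eval s ≤ e₂.eval s) :
      Exec W (.loop e₁ e₂ p) s (ticks (e₁.cost + e₂.cost + 1)) s

/-- The symbols visited in a run, in order. -/
def visits (tr : List Event) : List ℕ :=
  tr.filterMap fun
    | Event.tick => none
    | Event.visit r => some r

/-- The time before the first visit is at most `c`. -/
def InitTimeLE (c : ℕ) (tr : List Event) : Prop :=
  ∀ (k : ℕ) (v : List Event), tr = ticks k ++ v → k ≤ c

/-- From the first visit on, never more than `c` units of time pass without a visit: neither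
between two successive visits nor between the last visit and termination. -/
def DelayLE (c : ℕ) (tr : List Event) : Prop :=
  ∀ (u v : List Event) (k : ℕ), tr = u ++ ticks k ++ v → visits u ≠ [] → k ≤ c

/-- On the input `args`, and with machine words that hold the numbers up to `C * n`, the program
`p` terminates and visits the successive symbols of `S`; it reaches the first visit within time
`C * n`, and from then on every delay is at most `C`. -/
def LooplesslyGenerates (p : Cmd) (C n : ℕ) (args : List ℕ) (S : List ℕ) : Prop :=
  ∃ (tr : List Event) (s : Store), Exec (C * n) p (Store.input args) tr s ∧
    visits tr = S ∧ InitTimeLE (C * n) tr ∧ DelayLE C tr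

end Rotator

/-!
Unfolding the recursion, `recycleSeq k` is read by an odometer whose level `j ≤ k` holds a position
in a block of length `j` and the symbol there. Advancing it takes a carry through up to `k` levels,
but each of its symbols is output as a block of length `k + 1`. So the current symbol is saved, and
one step of the carry is performed per visit: when the block ends, the odometer is ready with the
next symbol, and all delays are bounded. After the last symbol the carry leaves the odometer at its
start, so that the repeated passes needed by rewinding require no initialization. Such a pass begins
at position `2` of the first block; the `k - 1` visits of that block still suffice for a carry,
because one more step is performed before them.
-/

namespace Rotator

/-- The symbol at position `d` of the block of length `n` by which recycling replaces `r`. -/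
def recycleSym (n d r : ℕ) : ℕ := if d ≤ 1 then n else if d ≤ r then n - 1 else n

/-- The symbol at position `d` of the block of length `n` by which reusing replaces `r`. -/
def reuseSym (n d r : ℕ) : ℕ := if d + 2 ≤ n then n else n + 1 - r

/-- The block of length `n` that replaces `r`, where `f n d r` is its symbol at position `d`. -/
def block (f : ℕ → ℕ → ℕ → ℕ) (n r : ℕ) : List ℕ := (List.range n).map fun d => f n d r

theorem recycleSym_le (n d r : ℕ) : recycleSym n d r ≤ n := by
  unfold recycleSym
  split_ifs <;> omega

theorem recycleSym_zero (n r : ℕ) : recycleSym n 0 r = n := by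
  simp [recycleSym]

theorem reuseSym_le (n d r : ℕ) : reuseSym n d r ≤ n + 1 := by
  unfold reuseSym
  split_ifs <;> omega

section Block

variable (f : ℕ → ℕ → ℕ → ℕ)

theorem drop_block (n d r : ℕ) :
    (block f n r).drop d = (List.range' d (n - d)).map fun d => f n d r := by
  rw [block, List.range_eq_range', ← List.map_drop, List.drop_range']
  simp

theorem drop_block_of_lt {n d : ℕ} (h : d < n) (r : ℕ) :
    (block f n r).drop d = f n d r :: (block f n r).drop (d + 1) := by
  rw [drop_block, drop_block, show n - d = n - (d + 1) + 1 by omega, List.range'_succ,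
    List.map_cons]

theorem drop_length_block (n r : ℕ) : (block f n r).drop n = [] := by
  simp [drop_block]

theorem block_succ_ne_nil (n r : ℕ) : block f (n + 1) r ≠ [] := by
  simp [block]

end Block

theorem recycle_block_eq {n r : ℕ} (hr : 1 ≤ r) (hrn : r < n) :
    [n, n] ++ List.replicate (r - 1) (n - 1) ++ List.replicate (n - r - 1) n =
      block recycleSym n r := by
  apply List.ext_getElem
  · simp only [block, List.length_append, List.length_cons, List.length_nil,
      List.length_replicate, List.length_map, List.length_range]
    omega
  · rintro (_ | _ | d) hd _
    · simp [block, recycleSym]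
    · simp [block, recycleSym]
    · simp only [block, recycleSym, List.getElem_map, List.getElem_range, List.getElem_append,
        List.getElem_replicate, List.length_append, List.length_cons, List.length_nil,
        List.length_replicate]
      split_ifs <;> first | rfl | omega

theorem reuse_block_eq {n : ℕ} (hn : 1 ≤ n) (r : ℕ) :
    List.replicate (n - 1) n ++ [n + 1 - r] = block reuseSym n r := by
  apply List.ext_getElem
  · simp only [block, List.length_append, List.length_replicate, List.length_singleton,
      List.length_map, List.length_range]
    omega
  · intro d hd _
    simp only [block, reuseSym, List.getElem_map, List.getElem_range, List.getElem_append,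
      List.getElem_replicate, List.length_replicate, List.getElem_singleton]
    split_ifs <;> first | rfl | omega

theorem mem_recycleSeq {k r : ℕ} (hr : r ∈ recycleSeq k) : 1 ≤ r ∧ r ≤ k := by
  induction k using recycleSeq.induct generalizing r with
  | case1 => simp [recycleSeq] at hr
  | case2 => simp_all [recycleSeq]
  | case3 k ih =>
    obtain ⟨q, hq, hr⟩ := List.mem_flatMap.1 hr
    have := ih hq
    simp only [List.cons_append, List.nil_append, List.mem_cons, List.mem_append,
      List.mem_replicate] at hr
    omega

theorem recycleSeq_succ {k : ℕ} (hk : 1 ≤ k) :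
    recycleSeq (k + 1) = (recycleSeq k).flatMap (block recycleSym (k + 1)) := by
  obtain ⟨k, rfl⟩ := Nat.exists_eq_add_of_le' hk
  refine List.flatMap_congr fun r hr => ?_
  have := mem_recycleSeq hr
  exact recycle_block_eq this.1 (by omega)

theorem reuse_eq_flatMap_block {n : ℕ} (hn : 1 ≤ n) (S : List ℕ) :
    reuse n S = S.flatMap (block reuseSym n) :=
  List.flatMap_congr fun r _ => reuse_block_eq hn r

theorem rewind_shiftTwo (n m : ℕ) (S : List ℕ) :
    rewind n m (shiftTwo S) =
      S.drop 2 ++ [n - 1, n] ++ (List.replicate (m - 2) (S.drop 2 ++ [n])).flatten ++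
        S.drop 2 ++ [n - 1, n] ++ List.replicate (m - 2) n := by
  have : (shiftTwo S).dropLast.dropLast = S.drop 2 := by
    match S with
    | [] => rfl
    | [_] => simp [shiftTwo]
    | a :: b :: l => simp [shiftTwo, List.dropLast_append_of_ne_nil]
  simp only [rewind, this]

/-- A position in `recycleSeq k`, in mixed radix: `digit j < j` is the position inside the current
block of length `j`, and `symbol j` is the symbol of `recycleSeq j` found there. The number
`overflow` is meant to become `0` when the counter advances to a further position, and to remain
nonzero when it returns to its start. The level `0` never changes. -/
structure Counter where
  digit : ℕ → ℕ
  symbol : ℕ → ℕ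
  overflow : ℕ

namespace Counter

/-- The counter whose level `j` is overwritten by the digit `d` and the symbol `r`. -/
def set (c : Counter) (j d r : ℕ) : Counter :=
  { c with digit := Function.update c.digit j d, symbol := Function.update c.symbol j r }

/-- Advances the counter at the levels up to `i` by one position. It is tail recursive, so that
its recursive calls can be carried out one at a time by a program. -/
def carry : ℕ → Counter → Counter
  | 0, c => c
  | i + 1, c =>
    if c.digit (i + 1) + 2 ≤ i + 1 then
      { c.set (i + 1) (c.digit (i + 1) + 1)
        (recycleSym (i + 1) (c.digit (i + 1) + 1) (c.symbol i)) with overflow := 0 }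
    else carry i (c.set (i + 1) 0 (i + 1))

/-- Up to level `k`, the digits are in range and the symbols are the ones at the positions they
describe. -/
def Valid (k : ℕ) (c : Counter) : Prop :=
  ∀ j < k, c.digit (j + 1) ≤ j ∧
    c.symbol (j + 1) = recycleSym (j + 1) (c.digit (j + 1)) (c.symbol j)

/-- Up to level `k`, the counter is at the first position. -/
def AtStart (k : ℕ) (c : Counter) : Prop :=
  ∀ j < k, c.digit (j + 1) = 0 ∧ c.symbol (j + 1) = j + 1

/-- The part of `recycleSeq k` from the current position on, if `1 ≤ k`. -/
def remaining : ℕ → Counter → List ℕ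
  | 0, c => [c.symbol 0]
  | k + 1, c => (block recycleSym (k + 1) (c.symbol k)).drop (c.digit (k + 1)) ++
      (remaining k c).tail.flatMap (block recycleSym (k + 1))

variable {k : ℕ} {c : Counter}

theorem valid_succ : Valid (k + 1) c ↔ Valid k c ∧ c.digit (k + 1) ≤ k ∧
    c.symbol (k + 1) = recycleSym (k + 1) (c.digit (k + 1)) (c.symbol k) :=
  Nat.forall_lt_succ_right

theorem atStart_succ :
    AtStart (k + 1) c ↔ AtStart k c ∧ c.digit (k + 1) = 0 ∧ c.symbol (k + 1) = k + 1 :=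
  Nat.forall_lt_succ_right

theorem AtStart.valid (h : AtStart k c) : Valid k c := fun j hj => by
  obtain ⟨hd, hr⟩ := h j hj
  rw [hd, hr, recycleSym_zero]
  exact ⟨j.zero_le, rfl⟩

theorem Valid.symbol_le (h : Valid k c) (hk : 1 ≤ k) : c.symbol k ≤ k := by
  obtain ⟨k, rfl⟩ := Nat.exists_eq_add_of_le' hk
  rw [(h k k.lt_succ_self).2]
  exact recycleSym_le _ _ _

theorem Valid.remaining_eq_cons (h : Valid k c) :
    remaining k c = c.symbol k :: (remaining k c).tail := by
  cases k with
  | zero => rfl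
  | succ k =>
    obtain ⟨hd, hr⟩ := h k k.lt_succ_self
    rw [remaining, drop_block_of_lt _ (by omega), hr]
    rfl

theorem Valid.tail_remaining_succ (h : Valid (k + 1) c) :
    (remaining (k + 1) c).tail =
      (block recycleSym (k + 1) (c.symbol k)).drop (c.digit (k + 1) + 1) ++
        (remaining k c).tail.flatMap (block recycleSym (k + 1)) := by
  have := (h k k.lt_succ_self).1
  rw [remaining, drop_block_of_lt _ (by omega)]
  rfl

theorem AtStart.remaining_eq (hk : 1 ≤ k) (h : AtStart k c) : remaining k c = recycleSeq k := by
  induction k, hk using Nat.le_induction with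
  | base => simp [remaining, recycleSeq, block, recycleSym, (h 0 one_pos).1]
  | succ k hk ih =>
    obtain ⟨h, hd, -⟩ := atStart_succ.1 h
    rw [recycleSeq_succ hk, ← ih h, remaining, hd, h.valid.remaining_eq_cons]
    rfl

theorem remaining_set {j : ℕ} (hj : k < j) (d r : ℕ) :
    remaining k (c.set j d r) = remaining k c := by
  induction k with
  | zero => simp [remaining, set, hj.ne]
  | succ k ih =>
    rw [remaining, remaining, ih (by omega)]
    simp [set, hj.ne, show k ≠ j by omega]

theorem remaining_overflow (o : ℕ) : remaining k { c with overflow := o } = remaining k c := by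
  induction k with
  | zero => rfl
  | succ k ih => rw [remaining, remaining, ih]

theorem valid_set {j : ℕ} (hj : k < j) (d r : ℕ) : Valid k (c.set j d r) ↔ Valid k c := by
  refine forall₂_congr fun i hi => ?_
  simp [set, show i + 1 ≠ j by omega, show i ≠ j by omega]

theorem atStart_set {j : ℕ} (hj : k < j) (d r : ℕ) : AtStart k (c.set j d r) ↔ AtStart k c := by
  refine forall₂_congr fun i hi => ?_
  simp [set, show i + 1 ≠ j by omega]

theorem carry_set {j : ℕ} (hj : k < j) (d r : ℕ) :
    carry k (c.set j d r) = (carry k c).set j d r := by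
  induction k generalizing c with
  | zero => rfl
  | succ k ih =>
    have comm (d' r' : ℕ) : (c.set j d r).set (k + 1) d' r' = (c.set (k + 1) d' r').set j d r := by
      simp only [set, Function.update_comm hj.ne]
    have hd : (c.set j d r).digit (k + 1) = c.digit (k + 1) := by simp [set, hj.ne]
    have hr : (c.set j d r).symbol k = c.symbol k := by simp [set, show k ≠ j by omega]
    simp only [carry, hd, hr, comm, ih (show k < j by omega)]
    split_ifs <;> rfl

theorem carry_succ_of_lt (h : c.digit (k + 1) < k) :
    carry (k + 1) c = { c.set (k + 1) (c.digit (k + 1) + 1)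
      (recycleSym (k + 1) (c.digit (k + 1) + 1) (c.symbol k)) with overflow := 0 } := by
  rw [carry, if_pos (by omega)]

theorem carry_succ_of_le (h : k ≤ c.digit (k + 1)) :
    carry (k + 1) c = (carry k c).set (k + 1) 0 (k + 1) := by
  rw [carry, if_neg (by omega), carry_set k.lt_succ_self]

theorem Valid.carry (h : Valid k c) : Valid k (carry k c) := by
  induction k generalizing c with
  | zero => exact h
  | succ k ih =>
    obtain ⟨hv, hd, -⟩ := valid_succ.1 h
    rw [valid_succ]
    rcases hd.lt_or_eq with hd | hd
    · rw [carry_succ_of_lt hd]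
      exact ⟨(valid_set k.lt_succ_self _ _).2 hv, by simpa [set] using hd, by simp [set]⟩
    · rw [carry_succ_of_le hd.ge]
      exact ⟨(valid_set k.lt_succ_self _ _).2 (ih hv), by simp [set, recycleSym_zero]⟩

theorem Valid.atStart_carry (h : Valid k c) (ht : (remaining k c).tail = []) :
    AtStart k (Counter.carry k c) ∧ (Counter.carry k c).overflow = c.overflow := by
  induction k generalizing c with
  | zero => exact ⟨fun j hj => absurd hj j.not_lt_zero, rfl⟩
  | succ k ih =>
    obtain ⟨hv, hd, -⟩ := valid_succ.1 h
    rw [h.tail_remaining_succ, List.append_eq_nil_iff, List.flatMap_eq_nil_iff] at ht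
    have hlast : k ≤ c.digit (k + 1) := by
      by_contra! hlt
      simp [drop_block_of_lt recycleSym (Nat.succ_lt_succ hlt)] at ht
    have htail : (remaining k c).tail = [] :=
      List.eq_nil_iff_forall_not_mem.2 fun r hr => block_succ_ne_nil _ _ _ (ht.2 r hr)
    obtain ⟨hs, ho⟩ := ih hv htail
    rw [carry_succ_of_le hlast, atStart_succ, atStart_set k.lt_succ_self]
    exact ⟨⟨hs, by simp [set]⟩, ho⟩

theorem Valid.remaining_carry (h : Valid k c) (ht : (remaining k c).tail ≠ []) :
    remaining k (Counter.carry k c) = (remaining k c).tail ∧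
      (Counter.carry k c).overflow = 0 := by
  induction k generalizing c with
  | zero => exact absurd rfl ht
  | succ k ih =>
    obtain ⟨hv, hd, -⟩ := valid_succ.1 h
    rw [h.tail_remaining_succ] at ht ⊢
    rcases hd.lt_or_eq with hd | hd
    · rw [carry_succ_of_lt hd]
      refine ⟨?_, rfl⟩
      rw [remaining_overflow, remaining, remaining_set k.lt_succ_self]
      simp [set]
    · rw [hd, drop_length_block, List.nil_append] at ht ⊢
      obtain ⟨hr, ho⟩ := ih hv fun htail => ht (by rw [htail, List.flatMap_nil])
      rw [carry_succ_of_le hd.ge, remaining, remaining_set k.lt_succ_self, ← hr]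
      refine ⟨?_, ho⟩
      conv_rhs => rw [hv.carry.remaining_eq_cons, List.flatMap_cons]
      simp [set]

/-- The symbols `l` are left to be read. When none is left, the counter has overflowed and is
ready to be read again. -/
def Awaits (k : ℕ) (c : Counter) : List ℕ → Prop
  | [] => AtStart k c ∧ c.overflow ≠ 0
  | r :: l => Valid k c ∧ remaining k c = r :: l ∧ c.overflow = 0

theorem Valid.awaits_carry {r : ℕ} {l : List ℕ} (h : Valid k c) (hl : remaining k c = r :: l)
    (ho : c.overflow ≠ 0) : Awaits k (Counter.carry k c) l := by
  have htail : (remaining k c).tail = l := by rw [hl, List.tail_cons]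
  cases l with
  | nil =>
    obtain ⟨hs, ho'⟩ := h.atStart_carry htail
    exact ⟨hs, ho'.trans_ne ho⟩
  | cons r' l =>
    obtain ⟨hr, ho'⟩ := h.remaining_carry (htail.trans_ne (List.cons_ne_nil r' l))
    exact ⟨h.carry, hr.trans htail, ho'⟩

end Counter

section Observes

/-- Reading the events `tr`, if the last visit was `g` units of time ago at their beginning: it is
never more than `P` units of time ago, and `R` holds of the visited symbols and of the time since
the last visit at their end. -/
def Observes (P : ℕ) : List Event → (List ℕ → ℕ → Prop) → ℕ → Prop
  | [], R, g => g ≤ P ∧ R [] g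
  | .tick :: tr, R, g => Observes P tr R (g + 1)
  | .visit r :: tr, R, g => g ≤ P ∧ Observes P tr (fun l => R (r :: l)) 0

variable {P g k : ℕ} {tr tr' : List Event} {R R' : List ℕ → ℕ → Prop}

theorem visits_append (tr tr' : List Event) : visits (tr ++ tr') = visits tr ++ visits tr' :=
  List.filterMap_append

theorem exists_eq_ticks (h : visits tr = []) : ∃ k, tr = ticks k := by
  induction tr with
  | nil => exact ⟨0, rfl⟩
  | cons a tr ih =>
    cases a with
    | tick =>
      obtain ⟨k, rfl⟩ := ih h
      exact ⟨k + 1, rfl⟩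
    | visit r => cases h

theorem Observes.le (h : Observes P tr R g) : g ≤ P := by
  induction tr generalizing g with
  | nil => exact h.1
  | cons a tr ih =>
    cases a with
    | tick => exact (Nat.le_succ g).trans (ih h)
    | visit r => exact h.1

theorem Observes.mono (h : Observes P tr R g) (hR : ∀ l g', g' ≤ P → R l g' → R' l g') :
    Observes P tr R' g := by
  induction tr generalizing g R R' with
  | nil => exact ⟨h.1, hR _ _ h.1 h.2⟩
  | cons a tr ih =>
    cases a with
    | tick => exact ih h hR
    | visit r => exact ⟨h.1, ih h.2 fun l => hR (r :: l)⟩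

theorem Observes.exists_forall (h : Observes P tr R g) :
    ∃ g', R (visits tr) g' ∧ ∀ R', R' (visits tr) g' → Observes P tr R' g := by
  induction tr generalizing g R with
  | nil => exact ⟨g, h.2, fun R' hR' => ⟨h.1, hR'⟩⟩
  | cons a tr ih =>
    cases a with
    | tick => exact ih h
    | visit r =>
      obtain ⟨g', hR, hR'⟩ := ih h.2
      exact ⟨g', hR, fun R' hr => ⟨h.1, hR' _ hr⟩⟩

theorem Observes.delayed {d g' : ℕ} (h : Observes P tr R g) (hg : g' ≤ g + d) :
    Observes (P + d) tr (fun _ _ => True) g' := by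
  induction tr generalizing g g' R with
  | nil => exact ⟨hg.trans (Nat.add_le_add_right h.1 d), trivial⟩
  | cons a tr ih =>
    cases a with
    | tick => exact ih h (by omega)
    | visit r => exact ⟨hg.trans (Nat.add_le_add_right h.1 d), ih h.2 (Nat.zero_le _)⟩

theorem observes_append : Observes P (tr ++ tr') R g ↔
    Observes P tr (fun l => Observes P tr' fun l' => R (l ++ l')) g := by
  induction tr generalizing g R with
  | nil => exact ⟨fun h => ⟨h.le, h⟩, And.right⟩
  | cons a tr ih =>
    cases a with
    | tick => exact ih
    | visit r => exact and_congr_right fun _ => ih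

theorem observes_ticks_append : Observes P (ticks k ++ tr) R g ↔ Observes P tr R (g + k) := by
  induction k generalizing g with
  | zero => rfl
  | succ k ih =>
    rw [show g + (k + 1) = g + 1 + k by omega, ← ih]
    rfl

theorem observes_ticks : Observes P (ticks k) R g ↔ g + k ≤ P ∧ R [] (g + k) := by
  rw [← List.append_nil (ticks k), observes_ticks_append, Observes]

theorem observes_ticks_append_visit {r : ℕ} :
    Observes P (ticks k ++ [Event.visit r]) R g ↔ g + k ≤ P ∧ R [r] 0 := by
  simp [observes_ticks_append, Observes]

theorem Observes.initTimeLE (h : Observes P tr R 0) : InitTimeLE P tr := by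
  rintro k v rfl
  exact (Nat.zero_add k).symm.trans_le (observes_ticks_append.1 h).le

theorem Observes.delayLE (htr : visits tr = []) (h : Observes P tr' R 0) :
    DelayLE P (tr ++ tr') := by
  intro u v k heq hu
  rw [List.append_assoc] at heq
  rcases List.prefix_or_prefix_of_prefix ⟨_, heq.symm⟩ (List.prefix_append tr tr')
    with ⟨w, rfl⟩ | ⟨w, rfl⟩
  · rw [visits_append, List.append_eq_nil_iff] at htr
    exact absurd htr.1 hu
  · rw [List.append_assoc, List.append_cancel_left_eq] at heq
    rw [heq, observes_append] at h
    obtain ⟨g, h, -⟩ := h.exists_forall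
    exact (Nat.le_add_left k g).trans (observes_ticks_append.1 h).le

end Observes

section WeakestPrecondition

/-- The weakest precondition of `Q` for the program `p`: in the state `s`, with the last visit `g`
units of time ago, `p` terminates on words holding the numbers up to `W`, the last visit is never
more than `P` units of time ago, and `Q` holds of the visited symbols, of the final state and of
the final time since the last visit. -/
def WP (W P : ℕ) (p : Cmd) (Q : List ℕ → Store → ℕ → Prop) (s : Store) (g : ℕ) : Prop :=
  ∃ (tr : List Event) (s' : Store), Exec W p s tr s' ∧ Observes P tr (fun l => Q l s') g

variable {W P : ℕ} {p q : Cmd} {e e₁ e₂ : Expr} {Q : List ℕ → Store → ℕ → Prop} {s : Store}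
  {g : ℕ}

theorem WP.mono {Q' : List ℕ → Store → ℕ → Prop} (h : WP W P p Q s g)
    (hQ : ∀ l s' g', g' ≤ P → Q l s' g' → Q' l s' g') : WP W P p Q' s g := by
  obtain ⟨tr, s', hrun, h⟩ := h
  exact ⟨tr, s', hrun, h.mono fun l => hQ l s'⟩

theorem wp_skip : WP W P .skip Q s g ↔ g + 1 ≤ P ∧ Q [] s (g + 1) := by
  constructor
  · rintro ⟨_, _, ⟨⟩, h⟩
    exact observes_ticks.1 h
  · exact fun h => ⟨_, _, .skip s, observes_ticks.2 h⟩

theorem wp_assign {x : ℕ} : WP W P (.assign x e) Q s g ↔ e.eval s ≤ W ∧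
    g + (e.cost + 1) ≤ P ∧ Q [] (s.setVar x (e.eval s)) (g + (e.cost + 1)) := by
  constructor
  · rintro ⟨_, _, ⟨⟩, h⟩
    exact ⟨‹_›, observes_ticks.1 h⟩
  · exact fun ⟨he, h⟩ => ⟨_, _, .assign s x e he, observes_ticks.2 h⟩

theorem wp_put {a : ℕ} {i : Expr} : WP W P (.put a i e) Q s g ↔
    i.eval s ≤ W ∧ e.eval s ≤ W ∧ g + (i.cost + e.cost + 1) ≤ P ∧
      Q [] (s.setArr a (i.eval s) (e.eval s)) (g + (i.cost + e.cost + 1)) := by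
  constructor
  · rintro ⟨_, _, ⟨⟩, h⟩
    exact ⟨‹_›, ‹_›, observes_ticks.1 h⟩
  · exact fun ⟨hi, he, h⟩ => ⟨_, _, .put s a i e hi he, observes_ticks.2 h⟩

theorem wp_visit : WP W P (.visit e) Q s g ↔
    e.eval s ≤ W ∧ g + (e.cost + 1) ≤ P ∧ Q [e.eval s] s 0 := by
  constructor
  · rintro ⟨_, _, ⟨⟩, h⟩
    exact ⟨‹_›, observes_ticks_append_visit.1 h⟩
  · exact fun ⟨he, h⟩ => ⟨_, _, .visit s e he, observes_ticks_append_visit.2 h⟩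

theorem wp_seq : WP W P (.seq p q) Q s g ↔
    WP W P p (fun l => WP W P q fun l' => Q (l ++ l')) s g := by
  constructor
  · rintro ⟨_, s'', _ | _ | _ | _ | ⟨_, _, _, s', _, tr, tr', hp, hq⟩, h⟩
    exact ⟨tr, s', hp, (observes_append.1 h).mono fun l g' _ h => ⟨tr', s'', hq, h⟩⟩
  · rintro ⟨tr, s', hp, h⟩
    obtain ⟨g', ⟨tr', s'', hq, h'⟩, htr⟩ := h.exists_forall
    exact ⟨tr ++ tr', s'', .seq _ _ _ _ _ _ _ hp hq, observes_append.2 (htr _ h')⟩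

theorem wp_ite : WP W P (.ite e₁ e₂ p q) Q s g ↔
    if e₁.eval s ≤ e₂.eval s then WP W P p Q s (g + (e₁.cost + e₂.cost + 1))
    else WP W P q Q s (g + (e₁.cost + e₂.cost + 1)) := by
  constructor
  · rintro ⟨_, s', _ | _ | _ | _ | _ | ⟨_, _, _, _, _, _, tr, hc, hrun⟩ |
      ⟨_, _, _, _, _, _, tr, hc, hrun⟩, h⟩
    · rw [if_pos hc]
      exact ⟨tr, s', hrun, observes_ticks_append.1 h⟩
    · rw [if_neg hc]
      exact ⟨tr, s', hrun, observes_ticks_append.1 h⟩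
  · intro h
    split_ifs at h with hc <;> obtain ⟨tr, s', hrun, h⟩ := h
    · exact ⟨_, s', .ite_true _ _ _ _ _ _ _ hc hrun, observes_ticks_append.2 h⟩
    · exact ⟨_, s', .ite_false _ _ _ _ _ _ _ hc hrun, observes_ticks_append.2 h⟩

theorem wp_loop : WP W P (.loop e₁ e₂ p) Q s g ↔
    if e₁.eval s ≤ e₂.eval s then
      WP W P (.seq p (.loop e₁ e₂ p)) Q s (g + (e₁.cost + e₂.cost + 1))
    else g + (e₁.cost + e₂.cost + 1) ≤ P ∧ Q [] s (g + (e₁.cost + e₂.cost + 1)) := by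
  constructor
  · rintro ⟨_, s'', _ | _ | _ | _ | _ | _ | _ | ⟨_, _, _, _, s', _, tr, tr', hc, hp, hl⟩ |
      ⟨_, _, _, _, hc⟩, h⟩
    · rw [if_pos hc]
      exact ⟨tr ++ tr', s'', .seq _ _ _ _ _ _ _ hp hl, observes_ticks_append.1 h⟩
    · rw [if_neg hc]
      exact observes_ticks.1 h
  · intro h
    split_ifs at h with hc
    · obtain ⟨_, s'', _ | _ | _ | _ | ⟨_, _, _, s', _, tr, tr', hp, hl⟩, h⟩ := h
      exact ⟨_, s'', .loop_true _ _ _ _ _ _ _ _ hc hp hl, observes_ticks_append.2 h⟩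
    · exact ⟨_, _, .loop_false _ _ _ _ hc, observes_ticks.2 h⟩

/-- The program `p` never assigns to the variable `x`. -/
def Cmd.Preserves (x : ℕ) : Cmd → Prop
  | skip | put _ _ _ | visit _ => True
  | assign y _ => x ≠ y
  | seq p q | ite _ _ p q => p.Preserves x ∧ q.Preserves x
  | loop _ _ p => p.Preserves x

theorem Exec.var_eq {x : ℕ} {tr : List Event} {s' : Store} (h : Exec W p s tr s')
    (hx : p.Preserves x) : s'.var x = s.var x := by
  induction h with
  | skip | put | visit | loop_false => rfl
  | assign => exact Function.update_of_ne hx _ _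
  | seq _ _ _ _ _ _ _ _ _ ihp ihq => exact (ihq hx.2).trans (ihp hx.1)
  | ite_true _ _ _ _ _ _ _ _ _ ih => exact ih hx.1
  | ite_false _ _ _ _ _ _ _ _ _ ih => exact ih hx.2
  | loop_true _ _ _ _ _ _ _ _ _ _ _ ihp ihl => exact (ihl hx).trans (ihp hx)

theorem WP.frame (h : WP W P p Q s g) :
    WP W P p (fun l s' g' => (∀ x, p.Preserves x → s'.var x = s.var x) ∧ Q l s' g') s g := by
  obtain ⟨tr, s', hrun, h⟩ := h
  exact ⟨tr, s', hrun, h.mono fun l g' _ hl => ⟨fun x hx => hrun.var_eq hx, hl⟩⟩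

theorem LooplesslyGenerates.of_wp {K C n : ℕ} {args S : List ℕ}
    (h : WP (C * n) K p (fun l s _ => l = [] ∧ WP (C * n) C q (fun l' _ _ => l' = S) s 0)
      (Store.input args) 0) (hK : C + K ≤ C * n) :
    LooplesslyGenerates (.seq p q) C n args S := by
  obtain ⟨tr, s, hp, h⟩ := h
  obtain ⟨g, ⟨htr, tr', s', hq, h'⟩, -⟩ := h.exists_forall
  obtain ⟨-, rfl, -⟩ := h'.exists_forall
  obtain ⟨k, rfl⟩ := exists_eq_ticks htr
  have hinit : InitTimeLE (C + K) (ticks k ++ tr') :=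
    (observes_ticks_append.2
      (h'.delayed ((observes_ticks.1 h).1.trans (Nat.le_add_left K 0)))).initTimeLE
  exact ⟨ticks k ++ tr', s', .seq _ _ _ _ _ _ _ hp hq,
    by rw [visits_append, htr, List.nil_append], fun j v hj => (hinit j v hj).trans hK,
    h'.delayLE htr⟩

section ForLoop

/-- Repeats `p` while the variable `x` counts up to the value of the variable `y`. -/
def forLoop (x y : ℕ) (p : Cmd) : Cmd :=
  .loop (.add (.var x) (.const 1)) (.var y) (.seq p (.assign x (.add (.var x) (.const 1))))

theorem WP.forLoop {x y i N : ℕ} {out : ℕ → List ℕ} {I : ℕ → Store → ℕ → Prop}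
    (hx : p.Preserves x) (hy : p.Preserves y) (hyx : y ≠ x) (hN : N ≤ W) (hiN : i ≤ N)
    (hbody : ∀ j s g, i ≤ j → j < N → s.var x = j → s.var y = N → I j s g →
      WP W P p (fun l s' g' => l = out j ∧ g' + 4 ≤ P ∧ I (j + 1) (s'.setVar x (j + 1)) (g' + 4))
        s (g + 5))
    (hdone : ∀ s' g', s'.var x = N → s'.var y = N → I N s' g' →
      g' + 5 ≤ P ∧ Q ((List.range' i (N - i)).flatMap out) s' (g' + 5))
    (hsx : s.var x = i) (hsy : s.var y = N) (hstart : I i s g) :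
    WP W P (Rotator.forLoop x y p) Q s g := by
  induction hk : N - i generalizing i s g Q with
  | zero =>
    obtain rfl : i = N := by omega
    rw [Rotator.forLoop, wp_loop, if_neg (by simp [Expr.eval, hsx, hsy])]
    simpa [Expr.cost] using hdone s g hsx hsy hstart
  | succ k ih =>
    have hlt : i < N := by omega
    rw [Rotator.forLoop, wp_loop, if_pos (by simpa [Expr.eval, hsx, hsy] using hlt), wp_seq, wp_seq]
    refine (hbody i s g le_rfl hlt hsx hsy hstart).frame.mono
      fun l s' g' _ ⟨hframe, hl, hg', hI⟩ => ?_
    have hx' := hframe x hx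
    have hy' := hframe y hy
    have heval : (Expr.add (.var x) (.const 1)).eval s' = i + 1 := by
      simp [Expr.eval, hx', hsx]
    rw [wp_assign, heval]
    refine ⟨by omega, hg', ?_⟩
    refine ih (by omega) (fun j s g hj => hbody j s g (by omega)) (fun s' g' hsx' hsy' hI' => ?_)
      (by simp [Store.setVar]) (by simp [Store.setVar, hyx, hy', hsy]) hI (by omega)
    have := hdone s' g' hsx' hsy' hI'
    rw [hk, List.range'_succ, List.flatMap_cons] at this
    simpa [hl, hk, show N - (i + 1) = k by omega] using this

end ForLoop

end WeakestPrecondition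

namespace Expr

/-- The expression with the value of `x` if `a ≤ b` and that of `y` otherwise. -/
def ifLE (a b x y : Expr) : Expr :=
  -- `x % (x + 1) = x`, whereas `x % x = 0`
  .add (.mod x (.add x (.sub (.const 1) (.sub a b))))
    (.mod y (.add y (.sub (.const 1) (.sub (.add b (.const 1)) a))))

theorem eval_ifLE (s : Store) (a b x y : Expr) :
    (ifLE a b x y).eval s = if a.eval s ≤ b.eval s then x.eval s else y.eval s := by
  split_ifs with h
  · simp [ifLE, eval, show a.eval s - b.eval s = 0 by omega,
      show 1 - (b.eval s + 1 - a.eval s) = 0 by omega]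
  · simp [ifLE, eval, show 1 - (a.eval s - b.eval s) = 0 by omega,
      show b.eval s + 1 - a.eval s = 0 by omega]

/-- The expression for `recycleSym`. -/
def recycleSym (n d r : Expr) : Expr :=
  ifLE d (.const 1) n (ifLE d r (.sub n (.const 1)) n)

/-- The expression for `reuseSym`. -/
def reuseSym (n d r : Expr) : Expr :=
  ifLE (.add d (.const 2)) n n (.sub (.add n (.const 1)) r)

theorem eval_recycleSym (s : Store) (n d r : Expr) :
    (recycleSym n d r).eval s = Rotator.recycleSym (n.eval s) (d.eval s) (r.eval s) := by
  simp only [recycleSym, Rotator.recycleSym, eval_ifLE, eval]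

theorem cost_recycleSym (n d r : Expr) :
    (recycleSym n d r).cost = 10 * n.cost + 6 * d.cost + 4 * r.cost + 49 := by
  simp only [recycleSym, ifLE, cost]
  omega

theorem eval_reuseSym (s : Store) (n d r : Expr) :
    (reuseSym n d r).eval s = Rotator.reuseSym (n.eval s) (d.eval s) (r.eval s) := by
  rw [reuseSym, eval_ifLE]
  rfl

end Expr

namespace Store

theorem var_setVar (s : Store) (x v y : ℕ) :
    (s.setVar x v).var y = if y = x then v else s.var y := by
  simp [setVar, Function.update_apply]

theorem arr_setVar (s : Store) (x v : ℕ) : (s.setVar x v).arr = s.arr := rfl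

theorem var_setArr (s : Store) (a i v : ℕ) : (s.setArr a i v).var = s.var := rfl

theorem arr_setArr (s : Store) (a i v b : ℕ) :
    (s.setArr a i v).arr b = if b = a then Function.update (s.arr a) i v else s.arr b := by
  simp [setArr, Function.update_apply]

end Store

namespace Reg

-- Inputs are passed in the variables numbered from `0`.
abbrev n : ℕ := 0
abbrev m : ℕ := 1
/-- The length of the blocks that are output. -/
abbrev len : ℕ := 2
/-- The position inside the current block. -/
abbrev pos : ℕ := 3
/-- The symbol of which the current block is the replacement. -/
abbrev sym : ℕ := 4
/-- The level at which the counter is to be advanced next. -/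
abbrev level : ℕ := 5
abbrev overflow : ℕ := 6
/-- The counter of repetitions. -/
abbrev rep : ℕ := 7

end Reg

namespace Arr

abbrev digit : ℕ := 0
abbrev symbol : ℕ := 1

end Arr

/-- The counter stored in memory. -/
def Store.counter (s : Store) : Counter where
  digit := s.arr Arr.digit
  symbol := s.arr Arr.symbol
  overflow := s.var Reg.overflow

/-- Adds one to the digit at the current level, whereupon no level is left to be advanced. -/
def increment : Cmd :=
  .seq (.put Arr.digit (.var Reg.level) (.add (.get Arr.digit (.var Reg.level)) (.const 1)))
    (.seq (.put Arr.symbol (.var Reg.level) (.recycleSym (.var Reg.level)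
        (.get Arr.digit (.var Reg.level))
        (.get Arr.symbol (.sub (.var Reg.level) (.const 1)))))
      (.seq (.assign Reg.overflow (.const 0)) (.assign Reg.level (.const 0))))

/-- Resets the digit at the current level and proceeds to the level below. -/
def reset : Cmd :=
  .seq (.put Arr.digit (.var Reg.level) (.const 0))
    (.seq (.put Arr.symbol (.var Reg.level) (.var Reg.level))
      (.assign Reg.level (.sub (.var Reg.level) (.const 1))))

/-- Carries out one recursive call of `Counter.carry`, if one is left. -/
def advance : Cmd :=
  .ite (.const 1) (.var Reg.level)
    (.ite (.add (.get Arr.digit (.var Reg.level)) (.const 2)) (.var Reg.level) increment reset)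
    .skip

section Advance

variable {W P : ℕ} {s : Store} {g i : ℕ}

-- The numerals in the bounds on time add up the costs of straight-line code.
theorem wp_increment (hlevel : s.var Reg.level = i + 1) (hdigit : s.arr Arr.digit (i + 1) ≤ i)
    (hW : i + 1 ≤ W) (hP : g + 99 ≤ P) :
    WP W P increment (fun l s' g' => l = [] ∧ g' = g + 99 ∧ s'.var Reg.level = 0 ∧
      s'.counter = { s.counter.set (i + 1) (s.counter.digit (i + 1) + 1)
        (recycleSym (i + 1) (s.counter.digit (i + 1) + 1) (s.counter.symbol i)) with
          overflow := 0 }) s g := by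
  have hsym := (recycleSym_le (i + 1) (s.arr Arr.digit (i + 1) + 1) (s.arr Arr.symbol i)).trans hW
  simp only [increment, Store.counter, Counter.set, Counter.mk.injEq, wp_seq,
    List.append_eq_nil_iff, wp_put, wp_assign, Expr.eval, hlevel, Expr.cost,
    Nat.reduceAdd, true_and, Store.var_setArr, Expr.eval_recycleSym, Store.arr_setArr,
    ↓reduceIte, Function.update_self, add_tsub_cancel_right, one_ne_zero, Expr.cost_recycleSym,
    Nat.reduceMul, zero_le, Store.var_setVar, Store.arr_setVar, zero_ne_one,
    OfNat.ofNat_eq_ofNat, Nat.succ_ne_self, and_self, and_true]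
  omega

theorem wp_reset (hlevel : s.var Reg.level = i + 1) (hW : i + 1 ≤ W) (hP : g + 10 ≤ P) :
    WP W P reset (fun l s' g' => l = [] ∧ g' = g + 10 ∧ s'.var Reg.level = i ∧
      s'.counter = s.counter.set (i + 1) 0 (i + 1)) s g := by
  simp only [reset, Store.counter, Counter.set, Counter.mk.injEq, wp_seq,
    List.append_eq_nil_iff, wp_put, wp_assign, Expr.eval, hlevel, Expr.cost,
    Nat.reduceAdd, true_and, Store.var_setArr, Store.arr_setArr, ↓reduceIte,
    add_tsub_cancel_right, one_ne_zero, zero_le, Store.var_setVar, Store.arr_setVar, zero_ne_one,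
    OfNat.ofNat_eq_ofNat, Nat.succ_ne_self, and_self, and_true]
  omega

theorem wp_advance (hW : s.var Reg.level ≤ W) (hP : g + 110 ≤ P) :
    WP W P advance (fun l s' g' => l = [] ∧ g' ≤ g + 110 ∧
      s'.var Reg.level ≤ s.var Reg.level - 1 ∧
      Counter.carry (s'.var Reg.level) s'.counter =
        Counter.carry (s.var Reg.level) s.counter) s g := by
  rw [advance, wp_ite]
  rcases hlevel : s.var Reg.level with _ | i
  · rw [if_neg (by simp [Expr.eval, hlevel]), wp_skip]
    simp only [Expr.cost, true_and]
    exact ⟨by omega, by omega, hlevel.le, by rw [hlevel]⟩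
  · rw [if_pos (by simp [Expr.eval, hlevel]), wp_ite]
    split_ifs with hdigit <;> simp only [Expr.eval, Expr.cost, hlevel] at hdigit ⊢
    · refine (wp_increment hlevel (by omega) (by omega) (by omega)).mono ?_
      rintro _ s' g' - ⟨rfl, rfl, hlevel', hc⟩
      refine ⟨rfl, by omega, by omega, ?_⟩
      rw [hlevel', hc, Counter.carry, Counter.carry_succ_of_lt (Nat.lt_of_add_lt_add_right hdigit)]
    · refine (wp_reset hlevel (by omega) (by omega)).mono ?_
      rintro _ s' g' - ⟨rfl, rfl, hlevel', hc⟩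
      refine ⟨rfl, by omega, by omega, ?_⟩
      rw [hlevel', hc]
      exact (if_neg hdigit).symm

end Advance

/-- The expression `e` computes the symbol at the current position of the current block, where
blocks are given by `f`. The bound on `f` is there because machine words are bounded. -/
structure Expr.Computes (e : Expr) (f : ℕ → ℕ → ℕ → ℕ) : Prop where
  eval_eq (s : Store) : e.eval s = f (s.var Reg.len) (s.var Reg.pos) (s.var Reg.sym)
  le (n d r : ℕ) : f n d r ≤ n + 1

/-- Visits the block that replaces the current symbol of the counter, from the current position
on, and meanwhile advances the counter by one position: one call of `Counter.carry` is carried out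
before the first visit and one after each visit. -/
def blockPass (e : Expr) : Cmd :=
  .seq (.assign Reg.sym (.get Arr.symbol (.sub (.var Reg.len) (.const 1))))
    (.seq (.assign Reg.level (.sub (.var Reg.len) (.const 1)))
      (.seq (.assign Reg.overflow (.const 1))
        (.seq advance
          (.seq (forLoop Reg.pos Reg.len (.seq (.visit e) advance))
            (.assign Reg.pos (.const 0))))))

/-- Visits the blocks that replace the remaining symbols of the counter. -/
def passLoop (e : Expr) : Cmd :=
  .loop (.var Reg.overflow) (.const 0) (blockPass e)

/-- Visits the blocks that replace all symbols of the counter, except for the first `d` symbols of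
the first block, and returns the counter to its start. -/
def pass (e : Expr) (d : ℕ) : Cmd :=
  .seq (.assign Reg.pos (.const d)) (.seq (blockPass e) (passLoop e))

section Pass

variable {W P k : ℕ} {s : Store} {g : ℕ} {e : Expr} {f : ℕ → ℕ → ℕ → ℕ}

theorem preserves_advance {x : ℕ} (hl : x ≠ Reg.level) (ho : x ≠ Reg.overflow) :
    advance.Preserves x := by
  simp [Cmd.Preserves, advance, increment, reset, hl, ho]

theorem wp_visit_advance (he : e.eval s ≤ W) (hW : s.var Reg.level ≤ W) (hP : 110 ≤ P)
    (hg : g + e.cost + 1 ≤ P) :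
    WP W P (.seq (.visit e) advance) (fun l s' g' => l = [e.eval s] ∧ g' ≤ 110 ∧
      s'.var Reg.level ≤ s.var Reg.level - 1 ∧ s'.var Reg.sym = s.var Reg.sym ∧
      Counter.carry (s'.var Reg.level) s'.counter =
        Counter.carry (s.var Reg.level) s.counter) s g := by
  rw [wp_seq, wp_visit]
  refine ⟨he, hg, (wp_advance hW (by omega)).frame.mono ?_⟩
  rintro _ s' g' - ⟨hframe, rfl, hg', hlevel, hc⟩
  exact ⟨rfl, by omega, hlevel, hframe _ (preserves_advance (by simp) (by simp)), hc⟩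

theorem wp_forLoop_visit {i r : ℕ} (he : e.Computes f) (hlen : s.var Reg.len = k + 1)
    (hpos : s.var Reg.pos = i) (hi : i ≤ k + 1) (hsym : s.var Reg.sym = r)
    (hlevel : s.var Reg.level ≤ k + 1 - i) (hW : k + 2 ≤ W)
    (hP : e.cost + 130 ≤ P) (hg : g + e.cost + 6 ≤ P) :
    WP W P (forLoop Reg.pos Reg.len (.seq (.visit e) advance))
      (fun l s' g' => l = (block f (k + 1) r).drop i ∧ s'.var Reg.len = k + 1 ∧
        s'.counter = Counter.carry (s.var Reg.level) s.counter ∧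
        g' ≤ (if i ≤ k then 119 else g + 5)) s g := by
  refine WP.forLoop (N := k + 1) (i := i) (out := fun d => [f (k + 1) d r])
    (I := fun j s' g' => g' ≤ (if j = i then g else 114) ∧ s'.var Reg.sym = r ∧
      s'.var Reg.level ≤ k + 1 - j ∧
      Counter.carry (s'.var Reg.level) s'.counter = Counter.carry (s.var Reg.level) s.counter)
    ?_ ?_ (by simp) (by omega) hi ?_ ?_ hpos hlen ?_
  · exact ⟨trivial, preserves_advance (by simp) (by simp)⟩
  · exact ⟨trivial, preserves_advance (by simp) (by simp)⟩
  · rintro j s₁ g₁ hij hj hpos₁ hlen₁ ⟨hg₁, hsym₁, hlevel₁, hc₁⟩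
    have heval : e.eval s₁ = f (k + 1) j r := by rw [he.eval_eq, hlen₁, hpos₁, hsym₁]
    have := he.le (k + 1) j r
    have hgap : g₁ + 5 + e.cost + 1 ≤ P := by split_ifs at hg₁ <;> omega
    refine (wp_visit_advance (by omega) (by omega) (by omega) hgap).mono ?_
    rintro _ s₂ g₂ - ⟨rfl, hg₂, hlevel₂, hsym₂, hc₂⟩
    refine ⟨by rw [heval], by omega, ?_, ?_, ?_, ?_⟩
    · rw [if_neg (by omega)]
      omega
    · simpa [Store.var_setVar] using hsym₂.trans hsym₁
    · simpa [Store.var_setVar] using (by omega : s₂.var Reg.level ≤ k + 1 - (j + 1))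
    · exact hc₂.trans hc₁
  · rintro s' g' - hlen' ⟨hg', -, hlevel', hc'⟩
    rw [Nat.sub_self, Nat.le_zero] at hlevel'
    rw [hlevel', Counter.carry] at hc'
    refine ⟨by split_ifs at hg' <;> omega, ?_, hlen', hc', by split_ifs at hg' ⊢ <;> omega⟩
    rw [drop_block, List.map_eq_flatMap]
  · simp [hsym, hlevel]

theorem wp_blockPass (he : e.Computes f) (hlen : s.var Reg.len = k + 1)
    (hpos : s.var Reg.pos ≤ 2) (hposk : s.var Reg.pos ≤ k + 1)
    (hsym : s.counter.symbol k ≤ k) (hW : k + 2 ≤ W) (hg : g + e.cost + 130 ≤ P) :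
    WP W P (blockPass e) (fun l s' g' =>
      l = (block f (k + 1) (s.counter.symbol k)).drop (s.var Reg.pos) ∧
      s'.var Reg.len = k + 1 ∧ s'.var Reg.pos = 0 ∧
      s'.counter = Counter.carry k { s.counter with overflow := 1 } ∧
      g' ≤ (if s.var Reg.pos ≤ k then 121 else g + 128)) s g := by
  have hlevel : (if Reg.len = Reg.sym then s.arr Arr.symbol k else k + 1) - 1 = k := rfl
  simp only [blockPass, wp_seq, wp_assign, Expr.eval, Expr.cost, Store.var_setVar, hlen,
    Nat.add_sub_cancel, Nat.reduceAdd, hlevel, List.nil_append]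
  refine ⟨hsym.trans (by omega), by omega, by omega, by omega, by omega, by omega,
    (wp_advance (by simpa [Store.var_setVar] using (by omega : k ≤ W)) (by omega)).frame.mono ?_⟩
  rintro _ s₁ g₁ - ⟨hframe, rfl, hg₁, hlevel₁, hc₁⟩
  have hlen₁ : s₁.var Reg.len = k + 1 :=
    (hframe _ (preserves_advance (by simp) (by simp))).trans hlen
  have hpos₁ : s₁.var Reg.pos = s.var Reg.pos :=
    hframe _ (preserves_advance (by simp) (by simp))
  have hsym₁ : s₁.var Reg.sym = s.counter.symbol k :=
    hframe _ (preserves_advance (by simp) (by simp))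
  replace hlevel₁ : s₁.var Reg.level ≤ k - 1 := hlevel₁
  refine wp_seq.2 ((wp_forLoop_visit he hlen₁ hpos₁ hposk hsym₁
    (hlevel₁.trans (by omega)) hW (by omega) (by omega)).mono ?_)
  rintro _ s₂ g₂ - ⟨rfl, hlen₂, hc₂, hg₂⟩
  simp only [wp_assign, Expr.eval, Expr.cost]
  refine ⟨by omega, by split_ifs at hg₂ <;> omega, by simp, hlen₂, by simp [Store.var_setVar],
    hc₂.trans hc₁, by split_ifs at hg₂ ⊢ <;> omega⟩

theorem wp_passLoop {l : List ℕ} (he : e.Computes f) (hk : 1 ≤ k) (hlen : s.var Reg.len = k + 1)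
    (hpos : s.var Reg.pos = 0) (hc : s.counter.Awaits k l) (hW : k + 2 ≤ W) (hP : e.cost + 254 ≤ P)
    (hg : g + e.cost + 133 ≤ P) :
    WP W P (passLoop e) (fun l' s' g' => l' = l.flatMap (block f (k + 1)) ∧
      s'.var Reg.len = k + 1 ∧ s'.counter.AtStart k ∧ g' ≤ max g 121 + 3) s g := by
  induction l generalizing s g with
  | nil =>
    have ho : s.var Reg.overflow ≠ 0 := hc.2
    rw [passLoop, wp_loop, if_neg (by simpa [Expr.eval] using ho)]
    simp only [Expr.cost]
    exact ⟨by omega, rfl, hlen, hc.1, by omega⟩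
  | cons r l ih =>
    obtain ⟨hv, hr, ho⟩ := hc
    obtain ⟨rfl, -⟩ := List.cons_eq_cons.1 (hv.remaining_eq_cons.symm.trans hr)
    have ho : s.var Reg.overflow = 0 := ho
    rw [passLoop, wp_loop, if_pos (by simp [Expr.eval, ho]), wp_seq]
    simp only [Expr.cost]
    refine (wp_blockPass he hlen (by omega) (by omega) (hv.symbol_le hk) hW
      (by omega)).mono ?_
    rintro _ s' g' - ⟨rfl, hlen', hpos', hc', hg'⟩
    rw [if_pos (by omega)] at hg'
    have hawaits : s'.counter.Awaits k l := by
      rw [hc']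
      exact Counter.Valid.awaits_carry hv ((Counter.remaining_overflow _).trans hr) one_ne_zero
    refine (ih hlen' hpos' hawaits (by omega)).mono ?_
    rintro _ s'' g'' - ⟨rfl, hlen'', hc'', hg''⟩
    exact ⟨by rw [hpos]; rfl, hlen'', hc'', by omega⟩

theorem wp_pass {d : ℕ} (he : e.Computes f) (hk : 1 ≤ k) (hd : d ≤ 2)
    (hlen : s.var Reg.len = k + 1) (hc : s.counter.AtStart k) (hW : k + 2 ≤ W)
    (hg : g + e.cost + 263 ≤ P) :
    WP W P (pass e d) (fun l s' g' =>
      l = ((recycleSeq k).flatMap (block f (k + 1))).drop d ∧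
      s'.var Reg.len = k + 1 ∧ s'.counter.AtStart k ∧ g' ≤ g + 133) s g := by
  have hv := hc.valid
  have hremaining := hv.remaining_eq_cons
  rw [hc.remaining_eq hk] at hremaining
  have hcounter : (s.setVar Reg.pos d).counter = s.counter := rfl
  have hpos : (s.setVar Reg.pos d).var Reg.pos = d := by simp [Store.var_setVar]
  rw [pass, wp_seq, wp_assign]
  simp only [Expr.eval, Expr.cost]
  refine ⟨by omega, by omega, ?_⟩
  rw [wp_seq]
  refine (wp_blockPass (s := s.setVar Reg.pos d) he hlen (hpos.trans_le hd) (by omega)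
    (hv.symbol_le hk) hW (by omega)).mono ?_
  rw [hcounter, hpos]
  rintro _ s' g' - ⟨rfl, hlen', hpos', hc', hg'⟩
  have hawaits : s'.counter.Awaits k (recycleSeq k).tail := by
    rw [hc']
    refine Counter.Valid.awaits_carry (r := s.counter.symbol k) hv ?_ one_ne_zero
    rw [Counter.remaining_overflow, hc.remaining_eq hk, ← hremaining]
  have hgap : g' ≤ g + 130 := by split_ifs at hg' <;> omega
  refine (wp_passLoop he hk hlen' hpos' hawaits hW (by omega) (by omega)).mono ?_
  rintro _ s'' g'' - ⟨rfl, hlen'', hc'', hg''⟩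
  refine ⟨?_, hlen'', hc'', by omega⟩
  rw [List.nil_append, hremaining, List.tail_cons, List.flatMap_cons,
    List.drop_append_of_le_length]
  simpa [block] using (by omega : d ≤ k + 1)

end Pass

/-- Stores `e` as the length of the blocks and puts the counter at its start. -/
def setup (e : Expr) : Cmd :=
  .seq (.assign Reg.len e) (forLoop Reg.rep Reg.len (.put Arr.symbol (.var Reg.rep) (.var Reg.rep)))

/-- Visits the block sequence without its first two symbols, then `n - 1` and `n`, and then runs
`p` another `m - 2` times. -/
def rewindHalf (e : Expr) (p : Cmd) : Cmd :=
  .seq (pass e 2) (.seq (.visit (.var Reg.len)) (.seq (.visit (.var Reg.n))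
    (.seq (.assign Reg.rep (.const 2)) (forLoop Reg.rep Reg.m p))))

/-- The program for `rewind n m (shiftTwo S)`, where `S` is the block sequence. -/
def rewindMain (e : Expr) : Cmd :=
  .seq (rewindHalf e (.seq (pass e 2) (.visit (.var Reg.n)))) (rewindHalf e (.visit (.var Reg.n)))

section Main

variable {W P k m : ℕ} {s : Store} {g : ℕ} {e : Expr} {f : ℕ → ℕ → ℕ → ℕ}

theorem wp_setup (he : e.eval s = k + 1) (hdigit : ∀ i, s.arr Arr.digit i = 0)
    (hrep : s.var Reg.rep = 0) (hW : k + 1 ≤ W) (hg : g + e.cost + 12 * (k + 1) + 6 ≤ P) :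
    WP W P (setup e)
      (fun l s' _ => l = [] ∧ s'.var Reg.len = k + 1 ∧ s'.counter.AtStart k) s g := by
  rw [setup, wp_seq, wp_assign, he]
  refine ⟨hW, by omega, WP.forLoop (N := k + 1) (i := 0) (out := fun _ => [])
    (I := fun j s' g' => g' ≤ g + (e.cost + 1) + 12 * j ∧ (∀ i, s'.arr Arr.digit i = 0) ∧
      ∀ i < j, s'.arr Arr.symbol i = i)
    trivial trivial (by simp) hW (Nat.zero_le _) ?_ ?_ ?_ ?_ ?_⟩
  · rintro j s₁ g₁ - hj hrep₁ hlen₁ ⟨hg₁, hdigit₁, hsymbol₁⟩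
    simp only [wp_put, Expr.eval, Expr.cost, hrep₁]
    refine ⟨by omega, by omega, by omega, trivial, by omega, by omega, hdigit₁, fun i hi => ?_⟩
    rcases Nat.lt_succ_iff_lt_or_eq.1 hi with hij | rfl
    · simpa [Store.arr_setVar, Store.arr_setArr, hij.ne] using hsymbol₁ i hij
    · simp [Store.arr_setVar, Store.arr_setArr]
  · rintro s₁ g₁ - hlen₁ ⟨hg₁, hdigit₁, hsymbol₁⟩
    refine ⟨by omega, ?_, hlen₁, fun j hj => ⟨hdigit₁ _, hsymbol₁ _ (by omega)⟩⟩
    simp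
  · simpa [Store.var_setVar] using hrep
  · simp [Store.var_setVar]
  · exact ⟨by simp, hdigit, by simp⟩

/-- The state between two passes of the program for `rewind (k + 2) m`. -/
structure Ready (k m : ℕ) (s : Store) : Prop where
  n : s.var Reg.n = k + 2
  m : s.var Reg.m = m
  len : s.var Reg.len = k + 1
  atStart : s.counter.AtStart k

theorem preserves_pass {x d : ℕ} (hx : x ∉ [Reg.pos, Reg.sym, Reg.level, Reg.overflow]) :
    (pass e d).Preserves x := by
  obtain ⟨hpos, hsym, hlevel, hoverflow⟩ : x ≠ Reg.pos ∧ x ≠ Reg.sym ∧ x ≠ Reg.level ∧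
    x ≠ Reg.overflow := by simpa using hx
  have hadvance := preserves_advance hlevel hoverflow
  simp [pass, passLoop, blockPass, forLoop, Cmd.Preserves, hpos, hsym, hlevel, hoverflow, hadvance]

theorem Ready.setVar_rep (h : Ready k m s) (v : ℕ) : Ready k m (s.setVar Reg.rep v) :=
  ⟨h.n, h.m, h.len, h.atStart⟩

theorem wp_rewindHalf {p : Cmd} {out : List ℕ} (he : e.Computes f) (hk : 1 ≤ k)
    (hm : 2 ≤ m) (hmk : m ≤ k + 2) (hW : k + 2 ≤ W)
    (hp : ∀ s g, g ≤ 9 → Ready k m s →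
      WP W P p (fun l s' g' => l = out ∧ Ready k m s' ∧ g' = 0) s g)
    (hpm : p.Preserves Reg.m) (hprep : p.Preserves Reg.rep) (hs : Ready k m s)
    (hg : g + e.cost + 270 ≤ P) :
    WP W P (rewindHalf e p) (fun l s' g' =>
      l = ((recycleSeq k).flatMap (block f (k + 1))).drop 2 ++ [k + 1, k + 2] ++
        (List.replicate (m - 2) out).flatten ∧ Ready k m s' ∧ g' ≤ 9) s g := by
  rw [rewindHalf, wp_seq]
  refine (wp_pass he hk le_rfl hs.len hs.atStart hW (by omega)).frame.mono ?_
  rintro _ s₁ g₁ - ⟨hframe, rfl, hlen₁, hc₁, hg₁⟩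
  have hn₁ := (hframe _ (preserves_pass (by simp))).trans hs.n
  have hm₁ := (hframe _ (preserves_pass (by simp))).trans hs.m
  simp only [wp_seq, wp_visit, wp_assign, Expr.eval, Expr.cost, hlen₁, hn₁]
  refine ⟨by omega, by omega, by omega, by omega, by omega, by omega, ?_⟩
  refine WP.forLoop (N := m) (i := 2) (out := fun _ => out)
    (I := fun _ s' g' => Ready k m s' ∧ g' ≤ 4) hprep hpm (by simp) (by omega) hm ?_ ?_ ?_ ?_ ?_
  · rintro j s' g' - - - - ⟨hs', hg'⟩
    refine (hp s' _ (by omega) hs').mono ?_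
    rintro l s'' g'' - ⟨rfl, hs'', rfl⟩
    exact ⟨rfl, by omega, hs''.setVar_rep _, le_rfl⟩
  · rintro s' g' - - ⟨hs', hg'⟩
    refine ⟨by omega, ?_, hs', by omega⟩
    simp [List.flatMap]
  · simp [Store.var_setVar]
  · simpa [Store.var_setVar] using hm₁
  · exact ⟨⟨hn₁, hm₁, hlen₁, hc₁⟩, by simp⟩

theorem wp_rewindMain (he : e.Computes f) (hk : 1 ≤ k)
    (hm : 2 ≤ m) (hmk : m ≤ k + 2) (hW : k + 2 ≤ W) (hs : Ready k m s)
    (hg : g + e.cost + 279 ≤ P) :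
    WP W P (rewindMain e) (fun l _ _ =>
      l = rewind (k + 2) m (shiftTwo ((recycleSeq k).flatMap (block f (k + 1))))) s g := by
  set T := ((recycleSeq k).flatMap (block f (k + 1))).drop 2 with hT
  have hpass (s g) (hg : g ≤ 9) (hs : Ready k m s) :
      WP W P (.seq (pass e 2) (.visit (.var Reg.n)))
        (fun l s' g' => l = T ++ [k + 2] ∧ Ready k m s' ∧ g' = 0) s g := by
    rw [wp_seq]
    refine (wp_pass he hk le_rfl hs.len hs.atStart hW (by omega)).frame.mono ?_
    rintro _ s₁ g₁ - ⟨hframe, rfl, hlen₁, hc₁, hg₁⟩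
    have hn₁ := (hframe _ (preserves_pass (by simp))).trans hs.n
    have hm₁ := (hframe _ (preserves_pass (by simp))).trans hs.m
    simp only [wp_visit, Expr.eval, Expr.cost, hn₁]
    exact ⟨hW, by omega, rfl, ⟨hn₁, hm₁, hlen₁, hc₁⟩, trivial⟩
  have hvisit (s g) (hg : g ≤ 9) (hs : Ready k m s) :
      WP W P (.visit (.var Reg.n)) (fun l s' g' => l = [k + 2] ∧ Ready k m s' ∧ g' = 0) s g := by
    simp only [wp_visit, Expr.eval, Expr.cost, hs.n, true_and, and_true]
    exact ⟨hW, by omega, hs⟩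
  rw [rewindMain, wp_seq]
  refine (wp_rewindHalf he hk hm hmk hW hpass ⟨preserves_pass (by simp), trivial⟩
    ⟨preserves_pass (by simp), trivial⟩ hs (by omega)).mono ?_
  rintro _ s₁ g₁ - ⟨rfl, hs₁, hg₁⟩
  refine (wp_rewindHalf he hk hm hmk hW hvisit trivial trivial hs₁ (by omega)).mono ?_
  rintro _ s₂ g₂ - ⟨rfl, -, -⟩
  rw [rewind_shiftTwo, ← hT]
  simp

theorem exists_looplesslyGenerates_flatMap_block (he : e.Computes f) :
    ∃ (p : Cmd) (C : ℕ), ∀ k, 1 ≤ k → LooplesslyGenerates p C (k + 1) [k + 1]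
      ((recycleSeq k).flatMap (block f (k + 1))) := by
  refine ⟨.seq (setup (.var Reg.n)) (pass e 0), e.cost + 500, fun k hk => ?_⟩
  have hW : k + 2 ≤ (e.cost + 500) * (k + 1) := by nlinarith
  refine .of_wp (K := 12 * (k + 1) + 7) ((wp_setup (k := k) rfl (fun _ => rfl) rfl (by omega)
    (by simp only [Expr.cost]; omega)).mono ?_) (by nlinarith)
  rintro _ s₁ g₁ - ⟨rfl, hlen₁, hc₁⟩
  refine ⟨rfl, (wp_pass he hk (Nat.zero_le 2) hlen₁ hc₁ hW (by omega)).mono ?_⟩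
  rintro _ s₂ g₂ - ⟨rfl, -⟩
  rfl

theorem exists_looplesslyGenerates_rewind (he : e.Computes f) :
    ∃ (p : Cmd) (C : ℕ), ∀ k m, 1 ≤ k → 2 ≤ m → m ≤ k + 2 →
      LooplesslyGenerates p C (k + 2) [k + 2, m]
        (rewind (k + 2) m (shiftTwo ((recycleSeq k).flatMap (block f (k + 1))))) := by
  refine ⟨.seq (setup (.sub (.var Reg.n) (.const 1))) (rewindMain e), e.cost + 500,
    fun k m hk hm hmk => ?_⟩
  have hW : k + 2 ≤ (e.cost + 500) * (k + 2) := by nlinarith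
  refine .of_wp (K := 12 * (k + 1) + 9) ((wp_setup (k := k) rfl (fun _ => rfl) rfl (by omega)
    (by simp only [Expr.cost]; omega)).frame.mono ?_) (by nlinarith)
  rintro _ s₁ g₁ - ⟨hframe, rfl, hlen₁, hc₁⟩
  have hs₁ : Ready k m s₁ := ⟨hframe _ (by simp [setup, forLoop, Cmd.Preserves]),
    hframe _ (by simp [setup, forLoop, Cmd.Preserves]), hlen₁, hc₁⟩
  exact ⟨rfl, wp_rewindMain he hk hm hmk hW hs₁ (by omega)⟩

end Main

theorem computes_recycleSym :
    (Expr.recycleSym (.var Reg.len) (.var Reg.pos) (.var Reg.sym)).Computes recycleSym where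
  eval_eq s := Expr.eval_recycleSym s _ _ _
  le n d r := (recycleSym_le n d r).trans n.le_succ

theorem computes_reuseSym :
    (Expr.reuseSym (.var Reg.len) (.var Reg.pos) (.var Reg.sym)).Computes reuseSym where
  eval_eq s := Expr.eval_reuseSym s _ _ _
  le := reuseSym_le

end Rotator

theorem mainTheorem8 :
    (∃ (p : Rotator.Cmd) (C : ℕ), ∀ n : ℕ, 2 ≤ n →
      Rotator.LooplesslyGenerates p C n [n]
        (Rotator.reuse n (Rotator.recycleSeq (n - 1)))) ∧
    (∃ (p : Rotator.Cmd) (C : ℕ), ∀ n m : ℕ, 3 ≤ n → 2 ≤ m → m ≤ n →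
      Rotator.LooplesslyGenerates p C n [n, m]
        (Rotator.rewind n m (Rotator.shiftTwo (Rotator.recycleSeq (n - 1))))) ∧
    (∃ (p : Rotator.Cmd) (C : ℕ), ∀ n m : ℕ, 3 ≤ n → 2 ≤ m → m ≤ n →
      Rotator.LooplesslyGenerates p C n [n, m]
        (Rotator.rewind n m
          (Rotator.shiftTwo (Rotator.reuse (n - 1) (Rotator.recycleSeq (n - 2)))))) := by
  obtain ⟨p, C, hp⟩ := Rotator.exists_looplesslyGenerates_flatMap_block Rotator.computes_reuseSym
  obtain ⟨q, D, hq⟩ := Rotator.exists_looplesslyGenerates_rewind Rotator.computes_recycleSym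
  obtain ⟨r, E, hr⟩ := Rotator.exists_looplesslyGenerates_rewind Rotator.computes_reuseSym
  refine ⟨⟨p, C, fun n hn => ?_⟩, ⟨q, D, fun n m hn hm hmn => ?_⟩, ⟨r, E, fun n m hn hm hmn => ?_⟩⟩
  · obtain ⟨k, rfl⟩ := Nat.exists_eq_add_of_le' (Nat.one_le_of_lt hn)
    rw [Nat.add_sub_cancel, Rotator.reuse_eq_flatMap_block k.succ_pos]
    exact hp k (by omega)
  · obtain ⟨k, rfl⟩ := Nat.exists_eq_add_of_le' (Nat.le_of_succ_le hn)
    rw [show k + 2 - 1 = k + 1 from rfl, Rotator.recycleSeq_succ (by omega)]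
    exact hq k m (by omega) hm hmn
  · obtain ⟨k, rfl⟩ := Nat.exists_eq_add_of_le' (Nat.le_of_succ_le hn)
    rw [Nat.add_sub_cancel, show k + 2 - 1 = k + 1 from rfl,
      Rotator.reuse_eq_flatMap_block k.succ_pos]
    exact hr k m (by omega) hm hmn
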